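/- Let $n,T_0,K\ge 1$ be integers and $\delta>0$. Let $\mathcal P$ be a probability distribution of valuations $(\mathbf b,s)\in[0,1]^n\times[0,1]$ of $n$ buyers and one seller. Let $\overline b$ be the highest entry of $\mathbf b$ and $\underline b$ the second highest, counted with multiplicity ($\underline b=0$ if $n=1$). For $(p,q)\in[0,1]^2$ put $$\mathsf{GFT}(p,q)=\mathbb E\big[(\overline b-s)\,\mathbb I(s\le p)\,\mathbb I(\overline b\ge q)\big],\qquad \mathsf{Rev}(p,q)=\mathbb E\big[(\max\{q,\underline b\}-p)\,\mathbb I(s\le p)\,\mathbb I(\overline b\ge q)\big],$$ and call $(p^*,q^*)\in[0,1]^2$ *optimal* if it maximizes $\mathsf{GFT}(p,q)$ over all $(p,q)\in[0,1]^2$ with $\mathsf{Rev}(p,q)\ge 0$. Given independent samples $(\mathbf b_1,s_1),\dots,(\mathbf b_{T_0},s_{T_0})$ from $\mathcal P$, build a grid of prices as follows. Let $p_0=0$ and, for $0\le k<K$, let $p_{k+1}$ be the largest $q\in\{\overline b_1,\dots,\overline b_{T_0}\}$ such that $|\{t: p_k<\overline b_t<q\}|\le T_0/K$ (and $p_{k+1}=1$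 if there is no such $q$). Let $\mathcal B^S=\{0,\tfrac1K,\tfrac2K,\dots,1\}$, $\mathcal B^B=\{p_0,\dots,p_K\}\cup\mathcal B^S$ and $\mathcal B=\mathcal B^S\times\mathcal B^B$. Given an optimal $(p^*,q^*)$, chosen independently of the samples, let $p_{k^*}$ be the smallest element of $\mathcal B^S$ with $p^*\le p_{k^*}$ and $q_{j^*}$ the smallest element of $\mathcal B^B$ with $q^*\le q_{j^*}$, so that $(p_{k^*},q_{j^*})\in\mathcal B$. 1. Suppose that $\mathcal P$ is the product of its marginals on buyers' and seller's valuations. If $(p^*,q^*)$ is optimal and either $p^*\in\mathcal B^S$ or $\mathbb P(s\le p^*)>0$, then with probability at least $1-\delta$ over the samples $$\mathsf{GFT}(p^*,q^*)-\mathsf{GFT}(p_{k^*},q_{j^*})\le \frac2K+\sqrt{\frac{\ln(2/\delta)}{2T_0}}.$$ Moreover, if there is an optimal pair at all, then there is one with $p^*\in\mathcal B^S$ or $\mathbb P(s\le p^*)>0$. 2. If $\mathcal P$ has a density with respect to Lebesgue measure on $[0,1]^{n+1}$ that is bounded by $M$, then for every optimal $(p^*,q^*)$, with probability at least $1-\delta$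 over the samples $$\mathsf{GFT}(p^*,q^*)-\mathsf{GFT}(p_{k^*},q_{j^*})\le \frac{M+1}K+\sqrt{\frac{\ln(2/\delta)}{2T_0}}.$$ (For $\delta\ge 1$ both claims are void.) -/

import Mathlib

open MeasureTheory ProbabilityTheory

namespace TwoSidedMarket

noncomputable section

/-- A valuation profile `(b, s)`: the valuations of the `n` buyers and that of the seller. -/
abbrev Valuation (n : ℕ) : Type := (Fin n → ℝ) × ℝ

/-- The unit cube `[0,1]^(n+1)` of admissible valuation profiles. -/
def cube (n : ℕ) : Set (Valuation n) :=
  {v | (∀ i, v.1 i ∈ Set.Icc (0 : ℝ) 1) ∧ v.2 ∈ Set.Icc (0 : ℝ) 1}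

/-- The highest buyer valuation. -/
def highest {n : ℕ} (b : Fin n → ℝ) : ℝ := ⨆ i, b i

/-- The second-highest buyer valuation, i.e. the highest valuation among the other buyers once
one highest-valuation buyer has been removed. Removing a highest bidder is what makes the maximum
over the remaining bidders smallest, so no tie-breaking rule is needed. With one buyer the value is
`0`, the supremum of the empty family in `ℝ`. -/
def secondHighest {n : ℕ} (b : Fin n → ℝ) : ℝ := ⨅ i, ⨆ j : {j : Fin n // j ≠ i}, b j

/-- Removing any highest-valuation buyer leaves `secondHighest b` as the highest valuation. -/
theorem secondHighest_eq {n : ℕ} (b : Fin n → ℝ) (w : Fin n) (hw : ∀ i, b i ≤ b w) :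
    secondHighest b = ⨆ j : {j : Fin n // j ≠ w}, b j := by
  have : Nonempty (Fin n) := ⟨w⟩
  apply le_antisymm
  · exact ciInf_le (Set.finite_range _).bddBelow w
  · apply le_ciInf
    intro i
    by_cases hiw : i = w
    · subst hiw; exact le_rfl
    · have hne : Nonempty {j : Fin n // j ≠ w} := ⟨⟨i, hiw⟩⟩
      apply ciSup_le
      intro j
      exact (hw j).trans
        (le_ciSup (f := fun j : {j : Fin n // j ≠ i} => b j) (Set.finite_range _).bddAbove
          ⟨w, fun h => hiw h.symm⟩)

/-- The gain from trade of the price pair `(p, q)` (`p` for the seller, reserve price `q` for the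
buyers) at a given valuation profile. -/
def gft {n : ℕ} (p q : ℝ) (v : Valuation n) : ℝ :=
  (highest v.1 - v.2) * (if v.2 ≤ p then 1 else 0) * (if q ≤ highest v.1 then 1 else 0)

/-- The revenue of the price pair `(p, q)` at a given valuation profile. -/
def rev {n : ℕ} (p q : ℝ) (v : Valuation n) : ℝ :=
  (max q (secondHighest v.1) - p) * (if v.2 ≤ p then 1 else 0)
    * (if q ≤ highest v.1 then 1 else 0)

/-- The expected gain from trade of `(p, q)`. -/
def GFT {n : ℕ} (P : Measure (Valuation n)) (p q : ℝ) : ℝ := ∫ v, gft p q v ∂P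

/-- The expected revenue of `(p, q)`. -/
def Rev {n : ℕ} (P : Measure (Valuation n)) (p q : ℝ) : ℝ := ∫ v, rev p q v ∂P

/-- The price pairs in `[0,1]²` with nonnegative expected revenue. -/
def feasible {n : ℕ} (P : Measure (Valuation n)) : Set (ℝ × ℝ) :=
  {r | r.1 ∈ Set.Icc (0 : ℝ) 1 ∧ r.2 ∈ Set.Icc (0 : ℝ) 1 ∧ 0 ≤ Rev P r.1 r.2}

/-- `(p, q)` is an optimal globally budget balanced price pair: it maximizes the expected gain
from trade among the pairs in `[0,1]²` with nonnegative expected revenue. -/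
def IsOptimalGBB {n : ℕ} (P : Measure (Valuation n)) (p q : ℝ) : Prop :=
  (p, q) ∈ feasible P ∧ ∀ r ∈ feasible P, GFT P r.1 r.2 ≤ GFT P p q

/-- The buyers' and the seller's valuations are independent: the joint law is the product of its
marginals. -/
def IsIndependent {n : ℕ} (P : Measure (Valuation n)) : Prop := P = P.fst.prod P.snd

/-- The joint law has a density bounded by `M` with respect to Lebesgue measure. -/
def HasDensityBoundedBy {n : ℕ} (P : Measure (Valuation n)) (M : ℝ) : Prop :=
  ∃ f : Valuation n → ENNReal, Measurable f ∧ (∀ᵐ v ∂volume, f v ≤ ENNReal.ofReal M) ∧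
    P = volume.withDensity f

/-- The points of the multiset `x₁, …, x_{T₀}` that are candidates for the grid point after `y`:
those `q` with at most `T₀ / K` sample points (counted with multiplicity) strictly between `y`
and `q`. -/
def candidates {T₀ : ℕ} (K : ℕ) (x : Fin T₀ → ℝ) (y : ℝ) : Finset ℝ :=
  (Finset.univ.image x).filter fun q =>
    ((Finset.univ.filter fun t => y < x t ∧ x t < q).card : ℝ) ≤ (T₀ : ℝ) / (K : ℝ)

/-- The adaptive grid points `p₀ = 0`, and `p_{k+1}` the largest candidate after `p_k`, or `1` if
there is no candidate. -/
def adaptivePoint {T₀ : ℕ} (K : ℕ) (x : Fin T₀ → ℝ) : ℕ → ℝ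
  | 0 => 0
  | k + 1 =>
    if h : (candidates K x (adaptivePoint K x k)).Nonempty then
      (candidates K x (adaptivePoint K x k)).max' h
    else 1

/-- The uniform grid `{0, 1/K, …, 1}`, which is the grid of seller prices. -/
def sellerGrid (K : ℕ) : Finset ℝ :=
  (Finset.range (K + 1)).image fun m : ℕ => (m : ℝ) / (K : ℝ)

/-- The grid of buyer prices: the adaptive points `p₀, …, p_K` and the uniform grid. -/
def buyerGrid {T₀ : ℕ} (K : ℕ) (x : Fin T₀ → ℝ) : Finset ℝ :=
  (Finset.range (K + 1)).image (adaptivePoint K x) ∪ sellerGrid K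

/-- The grid of price pairs computed, under global budget balance, from the highest buyer
valuations `x₁, …, x_{T₀}` observed in `T₀` rounds with reserve price `0`. -/
def gridEstimationGBB {T₀ : ℕ} (K : ℕ) (x : Fin T₀ → ℝ) : Finset (ℝ × ℝ) :=
  sellerGrid K ×ˢ buyerGrid K x

/-- The pair `r` of the grid computed from `x` is `(p, q)` rounded up: its entries are the smallest
seller grid price at least `p` and the smallest buyer grid price at least `q`. -/
def IsRoundUp {T₀ : ℕ} (K : ℕ) (x : Fin T₀ → ℝ) (p q : ℝ) (r : ℝ × ℝ) : Prop :=
  r ∈ gridEstimationGBB K x ∧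
    IsLeast {g : ℝ | g ∈ sellerGrid K ∧ p ≤ g} r.1 ∧
    IsLeast {g : ℝ | g ∈ buyerGrid K x ∧ q ≤ g} r.2

/-- The event that the rounded-up pair exists and loses at most `ε` in expected gain from trade
with respect to `(p, q)`, where the grid is computed from the valuation profiles `X₁, …, X_{T₀}`. -/
def lossAtMost {n T₀ : ℕ} {Ω : Type*} (P : Measure (Valuation n)) (K : ℕ)
    (X : Fin T₀ → Ω → Valuation n) (p q ε : ℝ) : Set Ω :=
  {ω | ∃ r : ℝ × ℝ, IsRoundUp K (fun t => highest (X t ω).1) p q r ∧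
    GFT P p q - GFT P r.1 r.2 ≤ ε}

end

end TwoSidedMarket

open TwoSidedMarket

namespace TwoSidedMarket

/-! ### The price grids -/

/-! Rounding $(p,q)$ up to $(p',q')$ changes the trades in two ways, and `GFT_sub_GFT_le` bounds the
loss by the two contributions.

Trades with $\overline b\in[q,q')$ are lost, each worth at most 1. The adaptive grid leaves at most
$T_0/K$ samples in $[q,q')$ (`card_filter_le_of_isLeast_buyerGrid`), and a deviation bound uniform
in $q'$ (`le_measureReal_forall_Ico`) turns this into mass at most
$1/K+\sqrt{\ln(2/\delta)/(2T_0)}$. As $q$ is fixed, uniformity costs no union bound: one critical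
interval decides all others.

Trades with $s\in(p,p']$ are added and may have negative gain. A density bounded by $M$ gives this
strip mass at most $M(p'-p)\le M/K$. Under independence, nonnegative revenue with $\mathbb P(s\le
p)>0$ forces $\mathbb E[(\overline b-p)\,\mathbb I(\overline b\ge q)]\ge0$, so the added trades lose
at most $p'-p\le 1/K$ on average. If $p$ is on the grid, no trade is added. -/

theorem candidates_nonempty {T₀ : ℕ} (hT₀ : 0 < T₀) (K : ℕ) (x : Fin T₀ → ℝ) (y : ℝ) :
    (candidates K x y).Nonempty := by
  have : Nonempty (Fin T₀) := ⟨⟨0, hT₀⟩⟩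
  -- No sample lies below the smallest one, so it is always a candidate; for $T_0\ge1$ the default
  -- value 1 of the grid is never taken.
  obtain ⟨t, ht⟩ := Finite.exists_min x
  refine ⟨x t, Finset.mem_filter.2 ⟨Finset.mem_image_of_mem _ (Finset.mem_univ _), ?_⟩⟩
  rw [Finset.filter_false_of_mem fun s _ hs => (ht s).not_gt hs.2]
  simp only [Finset.card_empty, Nat.cast_zero]
  positivity

theorem adaptivePoint_succ_mem {T₀ : ℕ} (hT₀ : 0 < T₀) (K : ℕ) (x : Fin T₀ → ℝ) (k : ℕ) :
    adaptivePoint K x (k + 1) ∈ candidates K x (adaptivePoint K x k) := by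
  rw [adaptivePoint, dif_pos (candidates_nonempty hT₀ K x _)]
  exact Finset.max'_mem _ _

theorem le_adaptivePoint_succ {T₀ : ℕ} (K : ℕ) (x : Fin T₀ → ℝ) (k : ℕ) {q : ℝ}
    (hq : q ∈ candidates K x (adaptivePoint K x k)) : q ≤ adaptivePoint K x (k + 1) := by
  rw [adaptivePoint, dif_pos ⟨q, hq⟩]
  exact Finset.le_max' _ _ hq

/-- The smallest sample above $p_{k+1}$ is not a candidate, so more than $T_0/K$ samples lie
strictly between $p_k$ and it. By minimality these are all at most $p_{k+1}$. -/
theorem card_lt_of_adaptivePoint_lt {T₀ : ℕ} (K : ℕ) (x : Fin T₀ → ℝ) (k : ℕ)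
    (h : ∃ t, adaptivePoint K x (k + 1) < x t) :
    ((Finset.univ.filter fun t => x t ≤ adaptivePoint K x k).card : ℝ) + (T₀ : ℝ) / K <
      (Finset.univ.filter fun t => x t ≤ adaptivePoint K x (k + 1)).card := by
  set y := adaptivePoint K x k
  set z := adaptivePoint K x (k + 1)
  obtain ⟨u, hu, hmin⟩ := Finset.exists_min_image (Finset.univ.filter fun t => z < x t) x
    (by obtain ⟨t, ht⟩ := h; exact ⟨t, by simpa using ht⟩)
  have hu' : z < x u := by simpa using hu
  have hbetween : ∀ t, x t < x u → x t ≤ z := fun t ht => by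
    by_contra! hlt
    exact (hmin t (by simpa using hlt)).not_gt ht
  have hcard : (T₀ : ℝ) / K < (Finset.univ.filter fun t => y < x t ∧ x t < x u).card := by
    by_contra! hle
    exact (le_adaptivePoint_succ K x k (Finset.mem_filter.2
      ⟨Finset.mem_image_of_mem _ (Finset.mem_univ u), hle⟩)).not_gt hu'
  obtain ⟨t₁, ht₁⟩ : (Finset.univ.filter fun t => y < x t ∧ x t < x u).Nonempty := by
    rw [← Finset.card_pos, ← Nat.cast_pos (α := ℝ)]
    exact lt_of_le_of_lt (by positivity) hcard
  have hyz : y ≤ z := by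
    have := (Finset.mem_filter.1 ht₁).2
    exact this.1.le.trans (hbetween t₁ this.2)
  have hdisj : Disjoint (Finset.univ.filter fun t => x t ≤ y)
      (Finset.univ.filter fun t => y < x t ∧ x t < x u) := by
    refine Finset.disjoint_filter.2 fun t _ h₁ h₂ => h₁.not_gt h₂.1
  have hsub : (Finset.univ.filter fun t => x t ≤ y) ∪
      (Finset.univ.filter fun t => y < x t ∧ x t < x u) ⊆ Finset.univ.filter fun t => x t ≤ z := by
    intro t ht
    simp only [Finset.mem_union, Finset.mem_filter, Finset.mem_univ, true_and] at ht ⊢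
    exact ht.elim (fun h => h.trans hyz) fun h => hbetween t h.2
  have := Finset.card_le_card hsub
  rw [Finset.card_union_of_disjoint hdisj] at this
  have : ((Finset.univ.filter fun t => x t ≤ y).card : ℝ) +
      (Finset.univ.filter fun t => y < x t ∧ x t < x u).card ≤
        (Finset.univ.filter fun t => x t ≤ z).card := by exact_mod_cast this
  linarith

/-- The adaptive points reach the largest sample within `K` steps. -/
theorem exists_forall_le_adaptivePoint {T₀ K : ℕ} (hK : 0 < K) (x : Fin T₀ → ℝ) :
    ∃ k ≤ K, ∀ t, x t ≤ adaptivePoint K x k := by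
  by_contra! hcon
  have key : ∀ k ≤ K, (k : ℝ) * ((T₀ : ℝ) / K) ≤
      (Finset.univ.filter fun t => x t ≤ adaptivePoint K x k).card := by
    intro k
    induction k with
    | zero => simp
    | succ k ih =>
      intro hk
      have := card_lt_of_adaptivePoint_lt K x k (hcon (k + 1) hk)
      have := ih (by omega)
      push_cast
      linarith
  -- At $k=K$ the count is at least $T_0$, yet some sample exceeds $p_K$.
  have hKK := key K le_rfl
  rw [mul_div_cancel₀ _ (by positivity)] at hKK
  obtain ⟨t, ht⟩ := hcon K le_rfl
  have hlt : (Finset.univ.filter fun t => x t ≤ adaptivePoint K x K).card <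
      (Finset.univ : Finset (Fin T₀)).card :=
    Finset.card_lt_card (Finset.filter_ssubset.2 ⟨t, Finset.mem_univ _, ht.not_ge⟩)
  rw [Finset.card_fin] at hlt
  exact (Nat.cast_le.1 hKK).not_gt hlt

/-- At most `T₀ / K` samples lie between a price and that price rounded up to the buyer grid. -/
theorem card_filter_le_of_isLeast_buyerGrid {T₀ K : ℕ} (hT₀ : 0 < T₀) (hK : 0 < K)
    (x : Fin T₀ → ℝ) {q r : ℝ} (hq : 0 ≤ q) (hr : IsLeast {g : ℝ | g ∈ buyerGrid K x ∧ q ≤ g} r) :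
    ((Finset.univ.filter fun t => q ≤ x t ∧ x t < r).card : ℝ) ≤ (T₀ : ℝ) / K := by
  classical
  have hnonneg : (0 : ℝ) ≤ (T₀ : ℝ) / K := by positivity
  have hmem : ∀ k ≤ K, adaptivePoint K x k ∈ buyerGrid K x := fun k hk =>
    Finset.mem_union_left _ (Finset.mem_image_of_mem _ (Finset.mem_range.2 (by omega)))
  -- For the first $j$ with $q\le p_j$, either $j=0$ and $[q,r)$ is empty, or
  -- $[q,r)\subseteq(p_{j-1},p_j)$ and $p_j$ is a candidate after $p_{j-1}$. If there is no such
  -- $j$, every sample is below $q$.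
  by_cases h : ∃ k, k ≤ K ∧ q ≤ adaptivePoint K x k
  · obtain ⟨hjK, hj⟩ := Nat.find_spec h
    have hmin := fun i => Nat.find_min h (m := i)
    generalize Nat.find h = j at hjK hj hmin
    have hrj : r ≤ adaptivePoint K x j := hr.2 ⟨hmem j hjK, hj⟩
    cases j with
    | zero =>
      rw [Finset.filter_false_of_mem]
      · simpa using hnonneg
      · rintro t - ⟨h₁, h₂⟩
        exact ((hq.trans h₁).trans_lt h₂).not_ge hrj
    | succ i =>
      have hi : adaptivePoint K x i < q := by
        by_contra! hcon
        exact hmin i (Nat.lt_succ_self i) ⟨by omega, hcon⟩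
      refine le_trans ?_ (Finset.mem_filter.1 (adaptivePoint_succ_mem hT₀ K x i)).2
      refine Nat.cast_le.2 (Finset.card_le_card fun t ht => ?_)
      simp only [Finset.mem_filter, Finset.mem_univ, true_and] at ht ⊢
      exact ⟨hi.trans_le ht.1, ht.2.trans_le hrj⟩
  · push Not at h
    obtain ⟨k, hk, hx⟩ := exists_forall_le_adaptivePoint hK x
    rw [Finset.filter_false_of_mem]
    · simpa using hnonneg
    · rintro t - ⟨h₁, -⟩
      exact (h₁.trans (hx t)).not_gt (h k hk)

theorem zero_mem_sellerGrid (K : ℕ) : (0 : ℝ) ∈ sellerGrid K :=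
  Finset.mem_image.2 ⟨0, by simp, by simp⟩

theorem one_mem_sellerGrid {K : ℕ} (hK : 0 < K) : (1 : ℝ) ∈ sellerGrid K :=
  Finset.mem_image.2 ⟨K, by simp, div_self (by positivity)⟩

/-- If $r>0$, minimality puts the preceding grid point $r-1/K$ below $p$. -/
theorem le_add_of_isLeast_sellerGrid {K : ℕ} (hK : 0 < K) {p r : ℝ} (hp : 0 ≤ p)
    (hr : IsLeast {g : ℝ | g ∈ sellerGrid K ∧ p ≤ g} r) : r ≤ p + 1 / K := by
  have hKpos : (0 : ℝ) < K := by positivity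
  obtain ⟨m, hm, hmr⟩ := Finset.mem_image.1 hr.1.1
  cases m with
  | zero =>
    rw [← hmr]
    simp only [Nat.cast_zero, zero_div]
    positivity
  | succ m =>
    have hmem : (m : ℝ) / K ∈ sellerGrid K :=
      Finset.mem_image_of_mem _ (by simp only [Finset.mem_range] at hm ⊢; omega)
    have hlt : (m : ℝ) / K < r := by
      rw [← hmr]
      gcongr
      simp
    have : (m : ℝ) / K < p := by
      by_contra! hcon
      exact (hr.2 ⟨hmem, hcon⟩).not_gt hlt
    rw [← hmr]
    push_cast
    rw [add_div]
    linarith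

theorem exists_isLeast_mem_finset {s : Finset ℝ} {p a : ℝ} (ha : a ∈ s) (hpa : p ≤ a) :
    ∃ r, IsLeast {g : ℝ | g ∈ s ∧ p ≤ g} r := by
  have hne : (s.filter (p ≤ ·)).Nonempty := ⟨a, Finset.mem_filter.2 ⟨ha, hpa⟩⟩
  have h := Finset.isLeast_min' _ hne
  rw [Finset.coe_filter] at h
  exact ⟨_, h⟩

theorem exists_isRoundUp {T₀ K : ℕ} (hK : 0 < K) (x : Fin T₀ → ℝ) {p q : ℝ} (hp : p ≤ 1)
    (hq : q ≤ 1) : ∃ r, IsRoundUp K x p q r := by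
  obtain ⟨a, ha⟩ := exists_isLeast_mem_finset (one_mem_sellerGrid hK) hp
  obtain ⟨b, hb⟩ := exists_isLeast_mem_finset (s := buyerGrid K x)
    (Finset.mem_union_right _ (one_mem_sellerGrid hK)) hq
  exact ⟨(a, b), Finset.mem_product.2 ⟨ha.1.1, hb.1.1⟩, ha, hb⟩

/-! ### Uniform deviation of the mass of intervals with a fixed left endpoint -/

/-- Hoeffding's inequality for the empirical frequency of a set. -/
theorem measureReal_card_filter_mem_le {α Ω : Type*} [MeasurableSpace α] [MeasurableSpace Ω]
    {μ : Measure Ω} [IsProbabilityMeasure μ] {ν : Measure α} {T : ℕ} (hT : 0 < T)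
    {Y : Fin T → Ω → α}
    (hY : ∀ t, Measurable (Y t)) (hlaw : ∀ t, μ.map (Y t) = ν) (hindep : iIndepFun Y μ)
    {A : Set α} [DecidablePred (· ∈ A)] (hA : MeasurableSet A) {a ε : ℝ} (hε : 0 ≤ ε)
    (haA : a + ε ≤ ν.real A) :
    μ.real {ω | ((Finset.univ.filter fun t => Y t ω ∈ A).card : ℝ) ≤ a * T} ≤
      Real.exp (-(2 * T * ε ^ 2)) := by
  -- The sign turns the lower tail of the count into the upper tail bounded by Hoeffding's
  -- inequality.
  let g : α → ℝ := A.indicator fun _ => -1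
  have hg : Measurable g := measurable_const.indicator hA
  have hint : ∀ t, ∫ ω, g (Y t ω) ∂μ = -ν.real A := fun t => by
    rw [← integral_map (hY t).aemeasurable hg.aestronglyMeasurable, hlaw t]
    simp [g, integral_indicator hA]
  have hsub : ∀ t ∈ Finset.univ, HasSubgaussianMGF (fun ω => g (Y t ω) + ν.real A)
      ((‖(0 : ℝ) - (-1)‖₊ / 2) ^ 2) μ := fun t _ => by
    have := hasSubgaussianMGF_of_mem_Icc (X := fun ω => g (Y t ω)) (μ := μ) (a := -1) (b := 0)
      (hg.comp (hY t)).aemeasurable (Filter.Eventually.of_forall fun ω => by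
        by_cases h : Y t ω ∈ A <;> simp [g, h])
    simpa [hint t] using this
  have hind : iIndepFun (fun t ω => g (Y t ω) + ν.real A) μ :=
    hindep.comp (fun _ y => g y + ν.real A) fun _ => hg.add_const _
  have hmain := HasSubgaussianMGF.measure_sum_ge_le_of_iIndepFun hind hsub
    (ε := T * ε) (by positivity)
  refine (measureReal_mono fun ω hω => ?_).trans (hmain.trans_eq ?_)
  · simp only [Set.mem_ofPred_eq] at hω ⊢
    have hsum : ∑ t, (g (Y t ω) + ν.real A) =
        T * ν.real A - (Finset.univ.filter fun t => Y t ω ∈ A).card := by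
      rw [Finset.sum_add_distrib, Finset.card_filter]
      simp only [g, Set.indicator_apply, Finset.sum_const, Finset.card_fin, nsmul_eq_mul]
      push_cast
      rw [sub_eq_neg_add, ← Finset.sum_neg_distrib]
      congr 1
      exact Finset.sum_congr rfl fun t _ => by split_ifs <;> simp
    rw [hsum]
    have : (T : ℝ) * (a + ε) ≤ T * ν.real A := by gcongr
    linarith
  · have : (T : ℝ) ≠ 0 := by positivity
    congr 1
    simp
    field_simp

/-- With high probability, all intervals `[q, z)` with small empirical frequency have small
mass. -/
theorem le_measureReal_forall_Ico {Ω : Type*} [MeasurableSpace Ω]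
    {μ : Measure Ω} [IsProbabilityMeasure μ] {ν : Measure ℝ} [IsProbabilityMeasure ν] {T : ℕ}
    (hT : 0 < T) {Y : Fin T → Ω → ℝ}
    (hY : ∀ t, Measurable (Y t)) (hlaw : ∀ t, μ.map (Y t) = ν) (hindep : iIndepFun Y μ)
    (q : ℝ) {a ε : ℝ} (ha : 0 ≤ a) (hε : 0 ≤ ε) :
    1 - Real.exp (-(2 * T * ε ^ 2)) ≤ μ.real {ω | ∀ z,
      ((Finset.univ.filter fun t => q ≤ Y t ω ∧ Y t ω < z).card : ℝ) ≤ a * T →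
        ν.real (Set.Ico q z) ≤ a + ε} := by
  classical
  -- The right endpoints of intervals that are too heavy. With $z_0=\inf S$, continuity of measure
  -- gives $\nu[q,z_0)\le a+\varepsilon\le\nu[q,z_0]$. Every heavy $[q,z)$ contains $[q,z_0]$, so
  -- Hoeffding for this single closed interval suffices.
  let S : Set ℝ := {z | a + ε < ν.real (Set.Ico q z)}
  rcases S.eq_empty_or_nonempty with hS | hS
  · have : {ω | ∀ z, ((Finset.univ.filter fun t => q ≤ Y t ω ∧ Y t ω < z).card : ℝ) ≤ a * T →
        ν.real (Set.Ico q z) ≤ a + ε} = Set.univ := by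
      refine Set.eq_univ_of_forall fun ω z _ => ?_
      by_contra! h
      exact (Set.eq_empty_iff_forall_notMem.1 hS) z h
    rw [this, probReal_univ]
    linarith [Real.exp_pos (-(2 * T * ε ^ 2))]
  have hbdd : BddBelow S := ⟨q, fun z hz => by
    by_contra! h
    have hz' : a + ε < ν.real (Set.Ico q z) := hz
    rw [Set.Ico_eq_empty (not_lt.2 h.le), measureReal_empty] at hz'
    linarith⟩
  set z₀ := sInf S
  have hleft : ν.real (Set.Ico q z₀) ≤ a + ε := by
    obtain ⟨u, humono, hult, hulim⟩ := exists_seq_strictMono_tendsto z₀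
    have hU : ⋃ n, Set.Ico q (u n) = Set.Ico q z₀ := by
      ext y
      simp only [Set.mem_iUnion, Set.mem_Ico, exists_and_left]
      refine and_congr_right fun _ => ⟨fun ⟨n, hn⟩ => hn.trans (hult n), fun hy => ?_⟩
      exact (hulim.eventually_const_lt hy).exists
    have hlim := tendsto_measure_iUnion_atTop (μ := ν) (s := fun n => Set.Ico q (u n))
      fun i j hij => Set.Ico_subset_Ico_right (humono.monotone hij)
    rw [hU] at hlim
    refine le_of_tendsto ((ENNReal.tendsto_toReal (measure_ne_top _ _)).comp hlim)
      (Filter.Eventually.of_forall fun n => ?_)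
    by_contra! h
    exact (csInf_le hbdd h).not_gt (hult n)
  have hright : a + ε ≤ ν.real (Set.Icc q z₀) := by
    obtain ⟨u, huanti, hult, hulim⟩ := exists_seq_strictAnti_tendsto z₀
    have hU : ⋂ n, Set.Ico q (u n) = Set.Icc q z₀ := by
      ext y
      simp only [Set.mem_iInter, Set.mem_Ico, Set.mem_Icc]
      refine ⟨fun h => ⟨(h 0).1, ge_of_tendsto' hulim fun n => (h n).2.le⟩,
        fun h n => ⟨h.1, h.2.trans_lt (hult n)⟩⟩
    have hlim := tendsto_measure_iInter_atTop (μ := ν) (s := fun n => Set.Ico q (u n))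
      (fun n => measurableSet_Ico.nullMeasurableSet)
      (fun i j hij => Set.Ico_subset_Ico_right (huanti.antitone hij))
      ⟨0, measure_ne_top _ _⟩
    rw [hU] at hlim
    refine ge_of_tendsto ((ENNReal.tendsto_toReal (measure_ne_top _ _)).comp hlim)
      (Filter.Eventually.of_forall fun n => ?_)
    obtain ⟨s, hs, hsu⟩ := exists_lt_of_csInf_lt hS (hult n)
    exact (le_of_lt hs).trans (measureReal_mono (Set.Ico_subset_Ico_right hsu.le))
  have hbad := measureReal_card_filter_mem_le hT hY hlaw hindep
    (measurableSet_Icc (a := q) (b := z₀)) hε hright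
  set B := {ω | ((Finset.univ.filter fun t => Y t ω ∈ Set.Icc q z₀).card : ℝ) ≤ a * T}
  -- Subadditivity is enough here, so measurability of $B$ need not be checked.
  have hone : 1 - μ.real B ≤ μ.real Bᶜ := by
    have := measureReal_union_le (μ := μ) B Bᶜ
    rw [Set.union_compl_self, probReal_univ] at this
    linarith
  refine (by linarith : _ ≤ μ.real Bᶜ).trans (measureReal_mono fun ω hω z hz => ?_)
  by_contra! h
  have hz₀ : z₀ < z := by
    by_contra! hle
    exact (h.trans_le (measureReal_mono (Set.Ico_subset_Ico_right hle))).not_ge hleft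
  refine hω (le_trans (Nat.cast_le.2 (Finset.card_le_card fun t ht => ?_)) hz)
  simp only [Finset.mem_filter, Finset.mem_univ, true_and, Set.mem_Icc] at ht ⊢
  exact ⟨ht.1, ht.2.trans_lt hz₀⟩

/-! ### Valuations and prices -/

@[fun_prop]
theorem measurable_highest {n : ℕ} : Measurable fun b : Fin n → ℝ => highest b := by
  unfold highest
  exact Measurable.iSup fun i => measurable_pi_apply i

theorem highest_mem_Icc {n : ℕ} {v : Valuation n} (hv : v ∈ cube n) :
    highest v.1 ∈ Set.Icc (0 : ℝ) 1 :=
  ⟨Real.iSup_nonneg fun i => (hv.1 i).1, Real.iSup_le (fun i => (hv.1 i).2) zero_le_one⟩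

theorem secondHighest_le_highest {n : ℕ} (hn : 1 ≤ n) {v : Valuation n} (hv : v ∈ cube n) :
    secondHighest v.1 ≤ highest v.1 := by
  have : Nonempty (Fin n) := ⟨⟨0, hn⟩⟩
  obtain ⟨w, hw⟩ := Finite.exists_max v.1
  rw [secondHighest_eq _ w hw]
  -- With one buyer the family is empty and its supremum is 0, hence the appeal to $\overline
  -- b\ge0$.
  exact Real.iSup_le (fun j => le_ciSup (Set.finite_range v.1).bddAbove j.1) (highest_mem_Icc hv).1

theorem measurable_ite_snd_le {n : ℕ} (p : ℝ) :
    Measurable fun v : Valuation n => if v.2 ≤ p then (1 : ℝ) else 0 :=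
  Measurable.ite (measurableSet_le measurable_snd measurable_const) measurable_const
    measurable_const

theorem measurable_ite_le_highest {n : ℕ} (q : ℝ) :
    Measurable fun b : Fin n → ℝ => if q ≤ highest b then (1 : ℝ) else 0 :=
  Measurable.ite (measurableSet_le measurable_const measurable_highest) measurable_const
    measurable_const

theorem measurable_gft {n : ℕ} (p q : ℝ) : Measurable (gft (n := n) p q) :=
  (((measurable_highest.comp measurable_fst).sub measurable_snd).mul
    (measurable_ite_snd_le p)).mul ((measurable_ite_le_highest q).comp measurable_fst)

theorem integrable_gft {n : ℕ} {P : Measure (Valuation n)} [IsProbabilityMeasure P]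
    (hP : ∀ᵐ v ∂P, v ∈ cube n) (p q : ℝ) : Integrable (gft p q) P := by
  refine Integrable.of_bound (measurable_gft p q).aestronglyMeasurable 1 ?_
  filter_upwards [hP] with v hv
  obtain ⟨h₁, h₂⟩ := highest_mem_Icc hv
  obtain ⟨h₃, h₄⟩ := hv.2
  rw [Real.norm_eq_abs, abs_le, gft]
  constructor <;> split_ifs <;> linarith

@[fun_prop]
theorem measurable_secondHighest {n : ℕ} : Measurable fun b : Fin n → ℝ => secondHighest b := by
  unfold secondHighest
  exact Measurable.iInf fun i => Measurable.iSup fun j => measurable_pi_apply j.1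

theorem integrable_rev {n : ℕ} (hn : 1 ≤ n) {P : Measure (Valuation n)} [IsProbabilityMeasure P]
    (hP : ∀ᵐ v ∂P, v ∈ cube n) (p q : ℝ) : Integrable (rev p q) P := by
  refine Integrable.of_bound ((((measurable_const.max
    (measurable_secondHighest.comp measurable_fst)).sub_const p).mul
    (measurable_ite_snd_le p)).mul
    ((measurable_ite_le_highest q).comp measurable_fst)).aestronglyMeasurable (|q| + 1 + |p|) ?_
  filter_upwards [hP] with v hv
  have h₁ := (secondHighest_le_highest hn hv).trans (highest_mem_Icc hv).2
  have h₂ : max q (secondHighest v.1) ≤ |q| + 1 :=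
    max_le (by linarith [le_abs_self q]) (by linarith [abs_nonneg q])
  have h₃ : q ≤ max q (secondHighest v.1) := le_max_left _ _
  have := neg_abs_le p
  have := le_abs_self p
  have := neg_abs_le q
  rw [Real.norm_eq_abs, abs_le, rev]
  constructor <;> split_ifs <;> linarith [abs_nonneg q]

/-- The loss from the trades with seller valuation in `(p, p']` at a buyer price `q'`. -/
noncomputable def sellerLoss {n : ℕ} (p p' q' : ℝ) (v : Valuation n) : ℝ :=
  (v.2 - highest v.1) * (if p < v.2 ∧ v.2 ≤ p' then 1 else 0) * (if q' ≤ highest v.1 then 1 else 0)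

theorem measurable_ite_snd_mem {n : ℕ} (p p' : ℝ) :
    Measurable fun v : Valuation n => if p < v.2 ∧ v.2 ≤ p' then (1 : ℝ) else 0 :=
  Measurable.ite ((measurableSet_lt measurable_const measurable_snd).inter
    (measurableSet_le measurable_snd measurable_const)) measurable_const measurable_const

theorem integrable_sellerLoss {n : ℕ} {P : Measure (Valuation n)} [IsProbabilityMeasure P]
    (hP : ∀ᵐ v ∂P, v ∈ cube n) (p p' q' : ℝ) : Integrable (sellerLoss p p' q') P := by
  refine Integrable.of_bound (((measurable_snd.sub (measurable_highest.comp measurable_fst)).mul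
    (measurable_ite_snd_mem p p')).mul
    ((measurable_ite_le_highest q').comp measurable_fst)).aestronglyMeasurable 1 ?_
  filter_upwards [hP] with v hv
  obtain ⟨h₁, h₂⟩ := highest_mem_Icc hv
  obtain ⟨h₃, h₄⟩ := hv.2
  rw [Real.norm_eq_abs, abs_le, sellerLoss]
  constructor <;> split_ifs <;> linarith

/-- The bound is pointwise: for $s\le p$ only $\overline b\in[q,q')$ matters, with gain at most 1;
for $p<s\le p'$ the difference is exactly the seller loss. -/
theorem GFT_sub_GFT_le {n : ℕ} {P : Measure (Valuation n)} [IsProbabilityMeasure P]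
    (hP : ∀ᵐ v ∂P, v ∈ cube n) {p p' q q' : ℝ} (hp : p ≤ p') (hq : q ≤ q') :
    GFT P p q - GFT P p' q' ≤
      (P.map fun v => highest v.1).real (Set.Ico q q') + ∫ v, sellerLoss p p' q' v ∂P := by
  have hmeas : Measurable fun v : Valuation n => highest v.1 :=
    measurable_highest.comp measurable_fst
  set A : Set (Valuation n) := (fun v => highest v.1) ⁻¹' Set.Ico q q'
  have hA : MeasurableSet A := hmeas measurableSet_Ico
  have hind : ∫ v, A.indicator (fun _ => (1 : ℝ)) v ∂P =
      (P.map fun v => highest v.1).real (Set.Ico q q') := by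
    rw [map_measureReal_apply hmeas measurableSet_Ico, integral_indicator hA]
    simp [A]
  have hindint : Integrable (A.indicator fun _ => (1 : ℝ)) P :=
    (integrable_const _).indicator hA
  rw [GFT, GFT, ← hind, ← integral_sub (integrable_gft hP p q) (integrable_gft hP p' q'),
    ← integral_add hindint (integrable_sellerLoss hP p p' q')]
  refine integral_mono_ae ((integrable_gft hP p q).sub (integrable_gft hP p' q'))
    (hindint.add (integrable_sellerLoss hP p p' q')) ?_
  filter_upwards [hP] with v hv
  obtain ⟨h₁, h₂⟩ := highest_mem_Icc hv
  obtain ⟨h₃, h₄⟩ := hv.2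
  have hAv : A.indicator (fun _ => (1 : ℝ)) v =
      if q ≤ highest v.1 ∧ highest v.1 < q' then 1 else 0 := by
    classical
    rw [Set.indicator_apply]
    exact if_congr Iff.rfl rfl rfl
  simp only [gft, sellerLoss, hAv]
  split_ifs <;> first | linarith | (exfalso; grind)

theorem integral_sellerLoss_self {n : ℕ} (P : Measure (Valuation n)) (p q' : ℝ) :
    ∫ v, sellerLoss p p q' v ∂P = 0 := by
  refine (integral_congr_ae (Filter.Eventually.of_forall fun v => ?_)).trans (integral_zero _ _)
  simp only [sellerLoss]
  rw [if_neg fun h => h.1.not_ge h.2]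
  simp

/-! ### Bounded density -/

/-- A negative $M$ is truncated to 0 by `ENNReal.ofReal`, and then the total mass would vanish. -/
theorem HasDensityBoundedBy.nonneg {n : ℕ} {P : Measure (Valuation n)} [IsProbabilityMeasure P]
    {M : ℝ} (hM : HasDensityBoundedBy P M) : 0 ≤ M := by
  obtain ⟨f, -, hfM, rfl⟩ := hM
  by_contra! h
  have : volume.withDensity f Set.univ = 0 := by
    rw [withDensity_apply _ MeasurableSet.univ, Measure.restrict_univ]
    refine (lintegral_congr_ae ?_).trans lintegral_zero
    filter_upwards [hfM] with v hv
    rw [ENNReal.ofReal_of_nonpos h.le] at hv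
    exact le_zero_iff.1 hv
  rw [measure_univ] at this
  exact one_ne_zero this

theorem HasDensityBoundedBy.measureReal_le {n : ℕ} {P : Measure (Valuation n)}
    [IsProbabilityMeasure P] (hP : ∀ᵐ v ∂P, v ∈ cube n) {M : ℝ} (hM : HasDensityBoundedBy P M)
    {p p' : ℝ} (hp : p ≤ p') : P.real {v | p < v.2 ∧ v.2 ≤ p'} ≤ M * (p' - p) := by
  have hM0 := hM.nonneg
  obtain ⟨f, -, hfM, hPf⟩ := hM
  -- Restricting to the buyers' cube, of volume 1, gives the strip volume $p'-p$; unrestricted it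
  -- can be infinite.
  let B : Set (Valuation n) := (Set.univ.pi fun _ => Set.Icc 0 1) ×ˢ Set.Ioc p p'
  have hB : MeasurableSet B :=
    (MeasurableSet.univ_pi fun _ => measurableSet_Icc).prod measurableSet_Ioc
  have hvol : volume B = ENNReal.ofReal (p' - p) := by
    rw [Measure.volume_eq_prod, Measure.prod_prod, volume_pi_pi]
    simp
  have hPB : P B ≤ ENNReal.ofReal (M * (p' - p)) := by
    rw [hPf, withDensity_apply _ hB, ENNReal.ofReal_mul hM0, ← hvol, ← setLIntegral_const]
    exact lintegral_mono_ae (ae_restrict_of_ae hfM)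
  have hle : P {v | p < v.2 ∧ v.2 ≤ p'} ≤ P B := by
    refine measure_mono_ae ?_
    filter_upwards [hP] with v hv hvp
    exact ⟨fun i _ => hv.1 i, hvp⟩
  exact ENNReal.toReal_le_of_le_ofReal (mul_nonneg hM0 (sub_nonneg.2 hp)) (hle.trans hPB)

theorem HasDensityBoundedBy.integral_sellerLoss_le {n : ℕ} {P : Measure (Valuation n)}
    [IsProbabilityMeasure P] (hP : ∀ᵐ v ∂P, v ∈ cube n) {M : ℝ} (hM : HasDensityBoundedBy P M)
    {p p' : ℝ} (hp : p ≤ p') (q' : ℝ) : ∫ v, sellerLoss p p' q' v ∂P ≤ M * (p' - p) := by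
  refine le_trans ?_ (hM.measureReal_le hP hp)
  have hA : MeasurableSet {v : Valuation n | p < v.2 ∧ v.2 ≤ p'} :=
    (measurableSet_lt measurable_const measurable_snd).inter
      (measurableSet_le measurable_snd measurable_const)
  have hind : ∫ v, {v : Valuation n | p < v.2 ∧ v.2 ≤ p'}.indicator (fun _ => (1 : ℝ)) v ∂P =
      P.real {v | p < v.2 ∧ v.2 ≤ p'} := by
    rw [integral_indicator hA]
    simp
  rw [← hind]
  refine integral_mono_ae (integrable_sellerLoss hP p p' q')
    ((integrable_const _).indicator hA) ?_
  filter_upwards [hP] with v hv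
  obtain ⟨h₁, h₂⟩ := highest_mem_Icc hv
  obtain ⟨h₃, h₄⟩ := hv.2
  simp only [sellerLoss, Set.indicator_apply, Set.mem_ofPred_eq]
  split_ifs <;> linarith

/-! ### Independent valuations -/

theorem IsIndependent.integral_mul {n : ℕ} {P : Measure (Valuation n)} [IsProbabilityMeasure P]
    (hI : IsIndependent P) {f : (Fin n → ℝ) → ℝ} {g : ℝ → ℝ} (hf : Measurable f)
    (hg : Measurable g) :
    ∫ v, f v.1 * g v.2 ∂P = (∫ v, f v.1 ∂P) * ∫ v, g v.2 ∂P := by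
  have h₁ : ∫ v, f v.1 ∂P = ∫ b, f b ∂P.fst :=
    (integral_map measurable_fst.aemeasurable hf.aestronglyMeasurable).symm
  have h₂ : ∫ v, g v.2 ∂P = ∫ s, g s ∂P.snd :=
    (integral_map measurable_snd.aemeasurable hg.aestronglyMeasurable).symm
  have hI' : P = P.fst.prod P.snd := hI
  rw [h₁, h₂, ← integral_prod_mul, ← hI']

theorem measurable_highest_sub_mul {n : ℕ} (p q : ℝ) :
    Measurable fun b : Fin n → ℝ => (highest b - p) * (if q ≤ highest b then 1 else 0) :=
  (measurable_highest.sub_const p).mul (measurable_ite_le_highest q)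

theorem integrable_highest_sub_mul {n : ℕ} {P : Measure (Valuation n)} [IsProbabilityMeasure P]
    (hP : ∀ᵐ v ∂P, v ∈ cube n) (p q : ℝ) :
    Integrable (fun v => (highest v.1 - p) * (if q ≤ highest v.1 then 1 else 0)) P := by
  refine Integrable.of_bound
    ((measurable_highest_sub_mul p q).comp measurable_fst).aestronglyMeasurable (1 + |p|) ?_
  filter_upwards [hP] with v hv
  obtain ⟨h₁, h₂⟩ := highest_mem_Icc hv
  rw [Real.norm_eq_abs, abs_le]
  have := neg_abs_le p
  have := le_abs_self p
  constructor <;> split_ifs <;> linarith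

/-- For independent valuations, a pair with nonnegative revenue has a seller price below the
average of the highest valuation over the traded buyers. -/
theorem IsIndependent.integral_highest_sub_nonneg {n : ℕ} (hn : 1 ≤ n) {P : Measure (Valuation n)}
    [IsProbabilityMeasure P] (hP : ∀ᵐ v ∂P, v ∈ cube n) (hI : IsIndependent P) {p q : ℝ}
    (hRev : 0 ≤ Rev P p q) (hpos : 0 < P {v | v.2 ≤ p}) :
    0 ≤ ∫ v, (highest v.1 - p) * (if q ≤ highest v.1 then 1 else 0) ∂P := by
  have hg : Measurable fun s : ℝ => if s ≤ p then (1 : ℝ) else 0 :=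
    Measurable.ite measurableSet_Iic measurable_const measurable_const
  have hA : MeasurableSet {v : Valuation n | v.2 ≤ p} :=
    measurableSet_le measurable_snd measurable_const
  have hprob : ∫ v, (if v.2 ≤ p then (1 : ℝ) else 0) ∂P = P.real {v | v.2 ≤ p} := by
    have : (fun v : Valuation n => if v.2 ≤ p then (1 : ℝ) else 0) =
      {v : Valuation n | v.2 ≤ p}.indicator fun _ => 1 := rfl
    rw [this, integral_indicator hA]
    simp
  have hreal : 0 < P.real {v | v.2 ≤ p} := ENNReal.toReal_pos hpos.ne' (measure_ne_top _ _)
  by_contra! hneg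
  -- Replacing $\max\{q,\underline b\}$ by the larger $\overline b$ bounds the revenue by an
  -- expectation that factors through $\mathbb P(s\le p)>0$; a negative first factor would make the
  -- revenue negative.
  have hprod := hI.integral_mul (measurable_highest_sub_mul p q) hg
  rw [hprob] at hprod
  have hint : Integrable (fun v : Valuation n =>
      (highest v.1 - p) * (if q ≤ highest v.1 then 1 else 0) * (if v.2 ≤ p then 1 else 0)) P := by
    refine (integrable_highest_sub_mul hP p q).mul_bdd (c := 1)
      (measurable_ite_snd_le p).aestronglyMeasurable (Filter.Eventually.of_forall fun v => ?_)
    split_ifs <;> simp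
  have hneg' := mul_neg_of_neg_of_pos hneg hreal
  rw [← hprod] at hneg'
  refine (hneg'.trans_le hRev).not_ge
    (integral_mono_ae (integrable_rev hn hP p q) hint ?_)
  filter_upwards [hP] with v hv
  have := secondHighest_le_highest hn hv
  simp only [rev]
  split_ifs with h₁ h₂ <;> simp
  exact ⟨h₂, this⟩

/-- On the strip $s\le p'$, so the loss is at most $-\mathbb E[(\overline b-p')\,\mathbb I(\overline
b\ge q')]\cdot\mathbb P(p<s\le p')$ by independence, and the first expectation is at least
$-(p'-p)$. -/
theorem IsIndependent.integral_sellerLoss_le {n : ℕ} (hn : 1 ≤ n) {P : Measure (Valuation n)}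
    [IsProbabilityMeasure P] (hP : ∀ᵐ v ∂P, v ∈ cube n) (hI : IsIndependent P) {p q : ℝ}
    (hRev : 0 ≤ Rev P p q) (hpos : 0 < P {v | v.2 ≤ p}) {p' q' : ℝ} (hp : p ≤ p')
    (hq : q ≤ q') : ∫ v, sellerLoss p p' q' v ∂P ≤ p' - p := by
  have hg : Measurable fun s : ℝ => if p < s ∧ s ≤ p' then (1 : ℝ) else 0 :=
    Measurable.ite measurableSet_Ioc measurable_const measurable_const
  have hbase := hI.integral_highest_sub_nonneg hn hP hRev hpos
  have hq' : 0 ≤ ∫ v, (highest v.1 - p) * (if q' ≤ highest v.1 then 1 else 0) ∂P := by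
    -- If $p\le q'$ the integrand is nonnegative; if $q'\le p$, raising $q$ to $q'$ removes only
    -- values $\overline b<p$, whose contribution is negative.
    rcases le_total p q' with h | h
    · refine integral_nonneg fun v => ?_
      simp only [Pi.zero_apply]
      split_ifs <;> linarith
    · refine hbase.trans (integral_mono (integrable_highest_sub_mul hP p q)
        (integrable_highest_sub_mul hP p q') fun v => ?_)
      simp only
      split_ifs <;> linarith
  have hle : -(p' - p) ≤ ∫ v, (highest v.1 - p') * (if q' ≤ highest v.1 then 1 else 0) ∂P := by
    have : ∫ v, ((highest v.1 - p) * (if q' ≤ highest v.1 then 1 else 0) - (p' - p)) ∂P ≤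
        ∫ v, (highest v.1 - p') * (if q' ≤ highest v.1 then 1 else 0) ∂P := by
      refine integral_mono ((integrable_highest_sub_mul hP p q').sub (integrable_const _))
        (integrable_highest_sub_mul hP p' q') fun v => ?_
      simp only
      split_ifs <;> linarith
    rw [integral_sub (integrable_highest_sub_mul hP p q') (integrable_const _)] at this
    simp only [integral_const, probReal_univ, one_smul] at this
    linarith
  have hgint : Integrable (fun v : Valuation n => if p < v.2 ∧ v.2 ≤ p' then (1 : ℝ) else 0) P :=
    Integrable.of_bound (measurable_ite_snd_mem p p').aestronglyMeasurable 1
      (Filter.Eventually.of_forall fun v => by split_ifs <;> simp)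
  have hg0 : 0 ≤ ∫ v, (if p < v.2 ∧ v.2 ≤ p' then (1 : ℝ) else 0) ∂P :=
    integral_nonneg fun v => by simp only [Pi.zero_apply]; split_ifs <;> simp
  have hg1 : ∫ v, (if p < v.2 ∧ v.2 ≤ p' then (1 : ℝ) else 0) ∂P ≤ 1 := by
    refine (integral_mono hgint (integrable_const 1) fun v => ?_).trans_eq (by simp)
    simp only
    split_ifs <;> simp
  have hprod := hI.integral_mul (measurable_highest_sub_mul p' q') hg
  have hprodint : Integrable (fun v : Valuation n => (highest v.1 - p') *
      (if q' ≤ highest v.1 then 1 else 0) * (if p < v.2 ∧ v.2 ≤ p' then 1 else 0)) P :=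
    (integrable_highest_sub_mul hP p' q').mul_bdd (c := 1)
      (measurable_ite_snd_mem p p').aestronglyMeasurable
      (Filter.Eventually.of_forall fun v => by split_ifs <;> simp)
  have hmono : ∫ v, sellerLoss p p' q' v ∂P ≤ -∫ v : Valuation n, (highest v.1 - p') *
      (if q' ≤ highest v.1 then 1 else 0) * (if p < v.2 ∧ v.2 ≤ p' then 1 else 0) ∂P := by
    rw [← integral_neg]
    refine integral_mono (integrable_sellerLoss hP p p' q') hprodint.neg fun v => ?_
    simp only [sellerLoss]
    split_ifs <;> linarith
  rw [hprod] at hmono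
  nlinarith

/-! ### Optimal pairs -/

/-- If $\mathbb P(s\le p)=0$, the optimal gain is 0. The pair $(0,q)$ attains it too, and is
feasible because $\max\{q,\underline b\}\ge0$. -/
theorem exists_isOptimalGBB_mem_sellerGrid {n : ℕ} {P : Measure (Valuation n)} (K : ℕ)
    (h : ∃ p q : ℝ, IsOptimalGBB P p q) :
    ∃ p q : ℝ, IsOptimalGBB P p q ∧ (p ∈ sellerGrid K ∨ 0 < P {v | v.2 ≤ p}) := by
  obtain ⟨p, q, hopt⟩ := h
  by_cases hpos : 0 < P {v | v.2 ≤ p}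
  · exact ⟨p, q, hopt, Or.inr hpos⟩
  have hzero : ∀ᵐ v ∂P, ¬ v.2 ≤ p := by
    rw [ae_iff]
    simpa using hpos
  obtain ⟨⟨hp, hq, -⟩, hmax⟩ := hopt
  have hGFT : ∀ p₁ ≤ p, GFT P p₁ q = 0 := fun p₁ hp₁ => by
    refine (integral_congr_ae ?_).trans (integral_zero _ _)
    filter_upwards [hzero] with v hv
    rw [gft, if_neg fun h => hv (h.trans hp₁)]
    simp
  refine ⟨0, q, ⟨⟨⟨le_rfl, zero_le_one⟩, hq, ?_⟩, fun r hr => ?_⟩, Or.inl (zero_mem_sellerGrid K)⟩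
  · refine integral_nonneg fun v => ?_
    have : q ≤ max q (secondHighest v.1) := le_max_left _ _
    have hq0 : (0 : ℝ) ≤ q := hq.1
    simp only [rev, Pi.zero_apply]
    split_ifs <;> linarith
  · rw [hGFT 0 hp.1, ← hGFT p le_rfl]
    exact hmax r hr

/-- The part common to both claims: $c$ bounds the seller loss, for all $q'\ge q$ since the rounded
buyer price depends on the samples. -/
theorem le_measureReal_lossAtMost {n T₀ K : ℕ} (hT₀ : 1 ≤ T₀) (hK : 1 ≤ K) {δ : ℝ} (hδ : 0 < δ)
    {P : Measure (Valuation n)} [IsProbabilityMeasure P] (hP : ∀ᵐ v ∂P, v ∈ cube n)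
    {Ω : Type*} [MeasurableSpace Ω] {μ : Measure Ω} [IsProbabilityMeasure μ]
    {X : Fin T₀ → Ω → Valuation n} (hX : ∀ t, Measurable (X t))
    (hlaw : ∀ t, μ.map (X t) = P) (hindep : iIndepFun X μ) {p q : ℝ}
    (hp : p ∈ Set.Icc (0 : ℝ) 1) (hq : q ∈ Set.Icc (0 : ℝ) 1) {c : ℝ}
    (hloss : ∀ p' q', IsLeast {g : ℝ | g ∈ sellerGrid K ∧ p ≤ g} p' → q ≤ q' →
      ∫ v, sellerLoss p p' q' v ∂P ≤ c) :
    1 - δ ≤ μ.real (lossAtMost P K X p q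
      (1 / K + c + Real.sqrt (Real.log (2 / δ) / (2 * T₀)))) := by
  rcases le_or_gt 1 δ with h1 | h1
  · exact (sub_nonpos.2 h1).trans measureReal_nonneg
  have hmeas : Measurable fun v : Valuation n => highest v.1 :=
    measurable_highest.comp measurable_fst
  have : IsProbabilityMeasure (P.map fun v => highest v.1) :=
    Measure.isProbabilityMeasure_map hmeas.aemeasurable
  have hTpos : (0 : ℝ) < T₀ := by positivity
  have hlog : 0 ≤ Real.log (2 / δ) := Real.log_nonneg (by rw [le_div_iff₀ hδ]; linarith)
  have hdev := le_measureReal_forall_Ico (μ := μ) (ν := P.map fun v => highest v.1) hT₀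
    (Y := fun t ω => highest (X t ω).1) (fun t => hmeas.comp (hX t))
    (fun t => by rw [← hlaw t, Measure.map_map hmeas (hX t)]; rfl)
    (hindep.comp (fun _ v => highest v.1) fun _ => hmeas) q (a := 1 / K) (by positivity)
    (Real.sqrt_nonneg (Real.log (2 / δ) / (2 * T₀)))
  -- The one-sided deviation bound fails with probability at most $\delta/2$, less than the allowed
  -- $\delta$.
  have hexp : Real.exp (-(2 * T₀ * Real.sqrt (Real.log (2 / δ) / (2 * T₀)) ^ 2)) = δ / 2 := by
    rw [Real.sq_sqrt (by positivity), mul_div_cancel₀ _ (by positivity), Real.exp_neg,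
      Real.exp_log (by positivity), inv_div]
  rw [hexp] at hdev
  refine (by linarith : 1 - δ ≤ 1 - δ / 2).trans (hdev.trans (measureReal_mono fun ω hω => ?_))
  obtain ⟨r, hr⟩ := exists_isRoundUp hK (fun t => highest (X t ω).1) hp.2 hq.2
  refine ⟨r, hr, (GFT_sub_GFT_le hP hr.2.1.1.2 hr.2.2.1.2).trans ?_⟩
  have h₁ := hω r.2 ((card_filter_le_of_isLeast_buyerGrid hT₀ hK _ hq.1 hr.2.2).trans_eq
    (by ring))
  have h₂ := hloss r.1 r.2 hr.2.1 hr.2.2.1.2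
  linarith

end TwoSidedMarket

theorem mainTheorem5 {n T₀ K : ℕ} (hn : 1 ≤ n) (hT₀ : 1 ≤ T₀) (hK : 1 ≤ K)
    {δ : ℝ} (hδ : 0 < δ)
    (P : Measure (Valuation n)) [IsProbabilityMeasure P] (hP : ∀ᵐ v ∂P, v ∈ cube n)
    {Ω : Type*} [MeasurableSpace Ω] (μ : Measure Ω) [IsProbabilityMeasure μ]
    (X : Fin T₀ → Ω → Valuation n) (hX : ∀ t, Measurable (X t))
    (hlaw : ∀ t, μ.map (X t) = P) (hindep : iIndepFun X μ) :
    (IsIndependent P →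
      (∀ p q : ℝ, IsOptimalGBB P p q → (p ∈ sellerGrid K ∨ 0 < P {v | v.2 ≤ p}) →
        1 - δ ≤ μ.real (lossAtMost P K X p q
          (2 / K + Real.sqrt (Real.log (2 / δ) / (2 * T₀))))) ∧
      ((∃ p q : ℝ, IsOptimalGBB P p q) →
        ∃ p q : ℝ, IsOptimalGBB P p q ∧ (p ∈ sellerGrid K ∨ 0 < P {v | v.2 ≤ p}))) ∧
    (∀ M : ℝ, HasDensityBoundedBy P M →
      ∀ p q : ℝ, IsOptimalGBB P p q →
        1 - δ ≤ μ.real (lossAtMost P K X p q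
          ((M + 1) / K + Real.sqrt (Real.log (2 / δ) / (2 * T₀))))) := by
  refine ⟨fun hI => ⟨fun p q hopt hpq => ?_, exists_isOptimalGBB_mem_sellerGrid K⟩,
    fun M hM p q hopt => ?_⟩
  · obtain ⟨⟨hp, hq, hRev⟩, -⟩ := hopt
    have h := le_measureReal_lossAtMost hT₀ hK hδ hP hX hlaw hindep hp hq (c := 1 / K)
      fun p' q' hp' hqq' => by
        rcases hpq with hgrid | hpos
        -- A grid price is its own rounding, so the strip $(p,p']$ is empty.
        · have : p' = p := le_antisymm (hp'.2 ⟨hgrid, le_rfl⟩) hp'.1.2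
          rw [this, integral_sellerLoss_self]
          positivity
        · have := hI.integral_sellerLoss_le hn hP hRev hpos hp'.1.2 hqq'
          have := le_add_of_isLeast_sellerGrid hK hp.1 hp'
          linarith
    rwa [← add_div, one_add_one_eq_two] at h
  · obtain ⟨⟨hp, hq, -⟩, -⟩ := hopt
    have h := le_measureReal_lossAtMost hT₀ hK hδ hP hX hlaw hindep hp hq (c := M * (1 / K))
      fun p' q' hp' _ => (hM.integral_sellerLoss_le hP hp'.1.2 q').trans
        (mul_le_mul_of_nonneg_left
          (by linarith [le_add_of_isLeast_sellerGrid hK hp.1 hp']) hM.nonneg)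
    rwa [mul_one_div, ← add_div, add_comm 1 M] at h
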